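/- Theorem 6 (Sharkovsky). Order the positive integers by Sharkovsky's ordering $$3 \prec 5 \prec 7 \prec \cdots \prec 2\cdot 3 \prec 2\cdot 5 \prec 2\cdot 7 \prec \cdots \prec 2^2\cdot 3 \prec 2^2\cdot 5 \prec 2^2\cdot 7 \prec \cdots \prec 2^3 \prec 2^2 \prec 2 \prec 1,$$ and write $m \preceq n$ for "$m = n$ or $m \prec n$". A point $y$ has least period $n \ge 1$ under $f$ if $f^n(y) = y$ and $f^i(y) \ne y$ for $0 < i < n$; its orbit $\{f^i(y) : i \ge 0\}$ is then called a period-$n$ orbit of $f$. The periods of $f$ are the least periods of its periodic points. (1) Let $f : I \to I$ be a continuous self-map of a compact interval $I$ (nonempty) with a point of least period $m$. Then $f$ has a point of least period $n$ for every $n$ with $m \prec n$. Moreover, if $I$ has more than one point, then for all $m, n \ge 1$, every continuous $f : I \to I$ that has a point of least period $m$ has a point of least period $n$ if and only if $m \preceq n$. (2) Conversely, for every compact interval $I$ with more than one point and every tail $S$ of the ordering (a nonempty set of positive integers such that $m \in S$ and $m \prec n$ imply $n \in S$), there is a continuous $f : I \to I$ whose set of periods is exactly $S$. (3) Explicitly,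 let $T(x) = 1 - |2x - 1|$ be the tent map on $[0,1]$, and for $0 \le c \le d \le 1$ let the truncation of $T$ to $[c,d]$ be the continuous map $x \mapsto \max(c, \min(d, T(x)))$ of $[0,1]$ into itself. For every $k \ge 1$ there is a period-$k$ orbit $P_k$ of $T$ of smallest diameter $\max P_k - \min P_k$ among the period-$k$ orbits of $T$; and for every such $P_k$ the set of periods of the truncation $T_k$ of $T$ to $[\min P_k, \max P_k]$ is exactly $\{n : k \preceq n\}$. (4) There are sets $Q_3, Q_6, Q_{12}, \dots$ such that $Q_3$ is a period-$3$ orbit of $T$ of smallest diameter and, for each $i \ge 0$, $Q_{2^{i+1}\cdot 3}$ has the smallest diameter among the period-$(2^{i+1}\cdot 3)$ orbits of $T$ contained in $[\min Q_{2^i \cdot 3}, \max Q_{2^i\cdot 3}]$. For every such sequence, with $q_0 = \sup_i \min Q_{2^i\cdot 3}$ and $q_1 = \inf_i \max Q_{2^i\cdot 3}$, the set of periods of the truncation $T_\infty$ of $T$ to $[q_0, q_1]$ is exactly $\{2^i : i \ge 0\}$. -/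

import Mathlib

namespace Sharkovsky

/-- Sharkovsky's (strict) ordering `m ≺ n` of the positive integers:
`3 ≺ 5 ≺ 7 ≺ ⋯ ≺ 2·3 ≺ 2·5 ≺ 2·7 ≺ ⋯ ≺ 2²·3 ≺ 2²·5 ≺ ⋯ ≺ 2³ ≺ 2² ≺ 2 ≺ 1`.
Every positive integer is uniquely `2 ^ a * p` with `p` odd. -/
def Prec (m n : ℕ) : Prop :=
  ∃ a p b q : ℕ, Odd p ∧ Odd q ∧ m = 2 ^ a * p ∧ n = 2 ^ b * q ∧
    ((1 < p ∧ 1 < q ∧ (a < b ∨ (a = b ∧ p < q))) ∨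
      (1 < p ∧ q = 1) ∨
      (p = 1 ∧ q = 1 ∧ b < a))

/-- The reflexive version `m ≼ n` of Sharkovsky's ordering. -/
def PrecEq (m n : ℕ) : Prop := m = n ∨ Prec m n

/-- A tail of Sharkovsky's ordering: a nonempty set of positive integers that contains, with
each of its elements, every later one. -/
def IsTail (S : Set ℕ) : Prop :=
  S.Nonempty ∧ (∀ n ∈ S, 0 < n) ∧ ∀ m ∈ S, ∀ n : ℕ, Prec m n → n ∈ S

/-- The set of `n ≥ 1` such that `f` has a point of least period `n`
(`Function.minimalPeriod` is `0` at points that are not periodic). -/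
def periods {α : Type*} (f : α → α) : Set ℕ :=
  {n | 0 < n ∧ ∃ x : α, Function.minimalPeriod f x = n}

/-- `P` is a period-`n` orbit of `f`: the orbit `{f^k(y) | k ≥ 0}` of a point `y` of least
period `n ≥ 1`. -/
def IsPeriodicOrbit {α : Type*} (f : α → α) (n : ℕ) (P : Set α) : Prop :=
  0 < n ∧ ∃ y : α, Function.minimalPeriod f y = n ∧ P = Set.range (fun k : ℕ => f^[k] y)

/-- The tent map `T(x) = 1 - |2x - 1|` of `[0, 1]`. -/
def tent (x : Set.Icc (0 : ℝ) 1) : Set.Icc (0 : ℝ) 1 :=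
  ⟨1 - |2 * (x : ℝ) - 1|, by
    have h0 := x.2.1
    have h1 := x.2.2
    have h : |2 * (x : ℝ) - 1| ≤ 1 := abs_le.mpr ⟨by linarith, by linarith⟩
    exact ⟨by linarith, by linarith [abs_nonneg (2 * (x : ℝ) - 1)]⟩⟩

/-- The tent map truncated at the heights `lo ≤ hi`: its value at `x` is `lo` if `T x ≤ lo`,
`hi` if `T x ≥ hi`, and `T x` otherwise. -/
noncomputable def truncTent (lo hi : Set.Icc (0 : ℝ) 1) (x : Set.Icc (0 : ℝ) 1) :
    Set.Icc (0 : ℝ) 1 :=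
  max lo (min hi (tent x))

/-- The diameter `max P - min P` of a (finite nonempty) set `P ⊆ [0, 1]`. Here `sSup` and
`sInf` are those of the complete lattice `[0, 1]`; on finite nonempty sets they are the
maximum and the minimum. -/
noncomputable def diam (P : Set (Set.Icc (0 : ℝ) 1)) : ℝ :=
  ((sSup P : Set.Icc (0 : ℝ) 1) : ℝ) - ((sInf P : Set.Icc (0 : ℝ) 1) : ℝ)

/-- `P` is a period-`n` orbit of the tent map that lies in `A` and has the smallest diameter
among all period-`n` orbits of the tent map that lie in `A`. -/
def IsSmallestOrbitIn (A : Set (Set.Icc (0 : ℝ) 1)) (n : ℕ) (P : Set (Set.Icc (0 : ℝ) 1)) :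
    Prop :=
  IsPeriodicOrbit tent n P ∧ P ⊆ A ∧
    ∀ R : Set (Set.Icc (0 : ℝ) 1), IsPeriodicOrbit tent n R → R ⊆ A → diam P ≤ diam R

/-- `Q 0, Q 1, Q 2, …` are nested choices of period-`3`, `6`, `12`, … orbits of the tent map:
`Q 0` has the smallest diameter among the period-`3` orbits, and `Q (i + 1)` has the smallest
diameter among the period-`2 ^ (i + 1) * 3` orbits in `[min (Q i), max (Q i)]`. -/
def IsNestedChoice (Q : ℕ → Set (Set.Icc (0 : ℝ) 1)) : Prop :=
  IsSmallestOrbitIn Set.univ 3 (Q 0) ∧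
    ∀ i : ℕ, IsSmallestOrbitIn (Set.Icc (sInf (Q i)) (sSup (Q i))) (2 ^ (i + 1) * 3) (Q (i + 1))

/-- The limiting truncation, at the heights `sup_i min (Q i)` and `inf_i max (Q i)`. -/
noncomputable def limTent (Q : ℕ → Set (Set.Icc (0 : ℝ) 1)) :
    Set.Icc (0 : ℝ) 1 → Set.Icc (0 : ℝ) 1 :=
  truncTent (⨆ i, sInf (Q i)) (⨅ i, sSup (Q i))

end Sharkovsky

/-!
If intervals `K 0, …, K n ⊇ K 0` are such that `f` maps each over the next, then some point of
`K 0` follows this loop and returns to itself. In a periodic orbit there are neighbours `a < b` that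
move towards each other, with a fixed point `c` between them. If every point of the orbit switches
sides about `c`, the period is even and swapping the two halves gives the period `2`; otherwise
some points are arranged like a horseshoe, which gives all even periods. An odd period is never of
the first kind, and a loop that lingers near `c` gives all larger odd periods. Applied to the
iterates `f^[2 ^ a]`, this spreads over the whole ordering.

Truncating `f` at the ends of a period-`k` orbit that has no other period-`k` orbit strictly inside
keeps only the periods forced by `k`: an earlier period would come from an orbit strictly inside,
and this would force another period-`k` orbit further inside. For the limit of the nested orbits
of period `2 ^ i * 3`, an earlier period can only come from an orbit through one of the two
truncation heights, whereas a period that is not a power of two would bring infinitely many.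
-/

namespace Sharkovsky

open Set Function

universe u

variable {α : Type u}

section Loops

lemma mem_periods_of_forall_not_isPeriodicPt {f : α → α} {n : ℕ} (hn : 0 < n) {x : α}
    (hx : IsPeriodicPt f n x) (h : ∀ d, 0 < d → d < n → ¬IsPeriodicPt f d x) :
    n ∈ periods f := by
  refine ⟨hn, x, (hx.minimalPeriod_le hn).eq_of_not_lt fun hlt => ?_⟩
  exact h _ (hx.minimalPeriod_pos hn) hlt (isPeriodicPt_minimalPeriod f x)

variable [ConditionallyCompleteLinearOrder α] [TopologicalSpace α] [OrderTopology α]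
  [DenselyOrdered α]

/- For `p ≤ q`: take the last point `p'` with the value `f p`, and after it the first point `q'`
with the value `f q`. -/
lemma exists_mapsTo_uIcc {β : Type*} [LinearOrder β] [TopologicalSpace β] [OrderClosedTopology β]
    {f : α → β} (hf : Continuous f) (p q : α) :
    ∃ p' ∈ uIcc p q, ∃ q' ∈ uIcc p q, f p' = f p ∧ f q' = f q ∧
      MapsTo f (uIcc p' q') (uIcc (f p) (f q)) := by
  wlog hpq : p ≤ q generalizing p q
  · obtain ⟨q', hq', p', hp', hfq, hfp, hmaps⟩ := this q p (le_of_not_ge hpq)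
    rw [uIcc_comm] at hp' hq' hmaps
    exact ⟨p', hp', q', hq', hfp, hfq, uIcc_comm (f q) (f p) ▸ hmaps⟩
  rw [uIcc_of_le hpq]
  have hclosed (y : β) : IsClosed {x | f x = y} := isClosed_eq hf continuous_const
  obtain ⟨p', ⟨hp', (hfp : f p' = f p)⟩, hlast⟩ :=
    (isCompact_Icc.inter_right (hclosed (f p))).exists_isGreatest ⟨p, left_mem_Icc.2 hpq, rfl⟩
  obtain ⟨q', ⟨hq', (hfq : f q' = f q)⟩, hfirst⟩ :=
    (isCompact_Icc.inter_right (hclosed (f q))).exists_isLeast ⟨q, right_mem_Icc.2 hp'.2, rfl⟩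
  refine ⟨p', hp', q', ⟨hp'.1.trans hq'.1, hq'.2⟩, hfp, hfq, fun t ht => ?_⟩
  rw [uIcc_of_le hq'.1] at ht
  by_contra hout
  have hcross : f q ∈ uIcc (f p') (f t) ∨ f p ∈ uIcc (f t) (f q') := by
    rw [hfp, hfq]
    simp only [mem_uIcc] at hout ⊢
    grind
  rcases hcross with h | h
  · obtain ⟨y, hy, hfy⟩ := intermediate_value_uIcc hf.continuousOn h
    rw [uIcc_of_le ht.1] at hy
    have hqy : q' ≤ y := hfirst ⟨⟨hy.1, hy.2.trans (ht.2.trans hq'.2)⟩, hfy⟩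
    obtain rfl : t = q' := ht.2.antisymm (hqy.trans hy.2)
    exact hout (hfq ▸ right_mem_uIcc)
  · obtain ⟨x, hx, hfx⟩ := intermediate_value_uIcc hf.continuousOn h
    rw [uIcc_of_le ht.2] at hx
    have hxp : x ≤ p' := hlast ⟨⟨hp'.1.trans (ht.1.trans hx.1), hx.2.trans hq'.2⟩, hfx⟩
    obtain rfl : t = p' := (hx.1.trans hxp).antisymm ht.1
    exact hout (hfp ▸ left_mem_uIcc)

variable {f : α → α}

lemma exists_uIcc_iterate_mem (hf : Continuous f) {K : ℕ → Set α}
    (hK : ∀ i, (K i).OrdConnected) {n : ℕ} (hcov : ∀ i < n, SurjOn f (K i) (K (i + 1)))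
    {r s : α} (hr : r ∈ K n) (hs : s ∈ K n) :
    ∃ p ∈ K 0, ∃ q ∈ K 0, f^[n] p = r ∧ f^[n] q = s ∧
      ∀ t ∈ uIcc p q, ∀ i ≤ n, f^[i] t ∈ K i := by
  induction n generalizing K with
  | zero =>
    refine ⟨r, hr, s, hs, rfl, rfl, fun t ht i hi => ?_⟩
    obtain rfl : i = 0 := Nat.le_zero.1 hi
    exact (hK 0).uIcc_subset hr hs ht
  | succ n ih =>
    obtain ⟨p₁, hp₁, q₁, hq₁, hfp, hfq, hpq⟩ := ih (K := fun i => K (i + 1))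
      (fun i => hK (i + 1)) (fun i hi => hcov (i + 1) (Nat.succ_lt_succ hi)) hr hs
    obtain ⟨p₀, hp₀, rfl⟩ := hcov 0 n.succ_pos hp₁
    obtain ⟨q₀, hq₀, rfl⟩ := hcov 0 n.succ_pos hq₁
    obtain ⟨p, hp, q, hq, hp_eq, hq_eq, hmaps⟩ := exists_mapsTo_uIcc hf p₀ q₀
    have hsub : uIcc p₀ q₀ ⊆ K 0 := (hK 0).uIcc_subset hp₀ hq₀
    refine ⟨p, hsub hp, q, hsub hq, by rw [iterate_succ_apply, hp_eq, hfp],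
      by rw [iterate_succ_apply, hq_eq, hfq], fun t ht i hi => ?_⟩
    cases i with
    | zero => exact hsub (uIcc_subset_uIcc hp hq ht)
    | succ i => exact hpq _ (hmaps ht) i (Nat.succ_le_succ_iff.1 hi)

lemma exists_isPeriodicPt_of_loop (hf : Continuous f) {K : ℕ → Set α}
    (hK : ∀ i, (K i).OrdConnected) {n : ℕ} (hcov : ∀ i < n, SurjOn f (K i) (K (i + 1)))
    {r s : α} (hr : r ∈ K n) (hs : s ∈ K n) (hrs : K 0 ⊆ Icc r s) :
    ∃ x, IsPeriodicPt f n x ∧ ∀ i ≤ n, f^[i] x ∈ K i := by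
  obtain ⟨p, hp, q, hq, hfp, hfq, hpq⟩ := exists_uIcc_iterate_mem hf hK hcov hr hs
  obtain ⟨x, hx, hfix⟩ := exists_mem_uIcc_isFixedPt (hf.iterate n).continuousOn
    (hfq.symm ▸ (hrs hq).2) (hfp.symm ▸ (hrs hp).1)
  exact ⟨x, hfix, hpq x (uIcc_comm p q ▸ hx)⟩

end Loops

section PeriodicOrbits

lemma mem_periods_iff_exists_isPeriodicOrbit {f : α → α} {n : ℕ} :
    n ∈ periods f ↔ ∃ P, IsPeriodicOrbit f n P :=
  ⟨fun ⟨hn, x, hx⟩ => ⟨_, hn, x, hx, rfl⟩, fun ⟨_, hn, x, hx, _⟩ => ⟨hn, x, hx⟩⟩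

lemma one_mem_periods_of_isFixedPt {f : α → α} {x : α} (hx : IsFixedPt f x) : 1 ∈ periods f :=
  ⟨one_pos, x, minimalPeriod_eq_one_iff_isFixedPt.2 hx⟩

namespace IsPeriodicOrbit

variable {f : α → α} {n : ℕ} {P : Set α} {x : α}

lemma nonempty (hP : IsPeriodicOrbit f n P) : P.Nonempty := by
  obtain ⟨-, y, -, rfl⟩ := hP
  exact range_nonempty _

lemma minimalPeriod_eq (hP : IsPeriodicOrbit f n P) (hx : x ∈ P) : minimalPeriod f x = n := by
  obtain ⟨hn, y, rfl, rfl⟩ := hP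
  obtain ⟨k, rfl⟩ := hx
  exact minimalPeriod_apply_iterate (minimalPeriod_pos_iff_mem_periodicPts.1 hn) k

lemma mem_periodicPts (hP : IsPeriodicOrbit f n P) (hx : x ∈ P) : x ∈ periodicPts f :=
  minimalPeriod_pos_iff_mem_periodicPts.1 ((hP.minimalPeriod_eq hx).symm ▸ hP.1)

lemma iterate_eq_self (hP : IsPeriodicOrbit f n P) (hx : x ∈ P) : f^[n] x = x :=
  hP.minimalPeriod_eq hx ▸ iterate_minimalPeriod

lemma not_isFixedPt (hP : IsPeriodicOrbit f n P) (hn : n ≠ 1) (hx : x ∈ P) : ¬IsFixedPt f x :=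
  fun h => hn (hP.minimalPeriod_eq hx ▸ minimalPeriod_eq_one_iff_isFixedPt.2 h)

lemma iterate_mem (hP : IsPeriodicOrbit f n P) (hx : x ∈ P) (k : ℕ) : f^[k] x ∈ P := by
  obtain ⟨-, y, -, rfl⟩ := hP
  obtain ⟨l, rfl⟩ := hx
  exact ⟨k + l, iterate_add_apply f k l y⟩

lemma apply_mem (hP : IsPeriodicOrbit f n P) (hx : x ∈ P) : f x ∈ P :=
  hP.iterate_mem hx 1

lemma exists_lt_iterate_eq (hP : IsPeriodicOrbit f n P) (hx : x ∈ P) {y : α} (hy : y ∈ P) :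
    ∃ k < n, f^[k] x = y := by
  suffices h : ∃ k, f^[k] x = y by
    obtain ⟨k, rfl⟩ := h
    exact ⟨k % n, Nat.mod_lt _ hP.1, IsPeriodicPt.iterate_mod_apply (hP.iterate_eq_self hx) k⟩
  obtain ⟨hn, z, rfl, rfl⟩ := hP
  obtain ⟨i, rfl⟩ := hx
  obtain ⟨j, rfl⟩ := hy
  have hi : i ≤ minimalPeriod f z * i := Nat.le_mul_of_pos_left i hn
  have hz : f^[minimalPeriod f z * i] z = z := (isPeriodicPt_minimalPeriod f z).mul_const i
  exact ⟨j + (minimalPeriod f z * i - i), by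
    rw [← iterate_add_apply, add_assoc, Nat.sub_add_cancel hi, iterate_add_apply, hz]⟩

lemma exists_apply_eq (hP : IsPeriodicOrbit f n P) (hx : x ∈ P) : ∃ y ∈ P, f y = x := by
  refine ⟨f^[n - 1] x, hP.iterate_mem hx _, ?_⟩
  rw [← iterate_succ_apply' f, Nat.succ_eq_add_one, Nat.sub_add_cancel hP.1, hP.iterate_eq_self hx]

lemma injOn (hP : IsPeriodicOrbit f n P) : InjOn f P :=
  (bijOn_periodicPts f).injOn.mono fun _ => hP.mem_periodicPts

lemma eq_image (hP : IsPeriodicOrbit f n P) (hx : x ∈ P) :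
    P = (fun k => f^[k] x) '' Iio n := by
  ext y
  refine ⟨hP.exists_lt_iterate_eq hx, ?_⟩
  rintro ⟨k, -, rfl⟩
  exact hP.iterate_mem hx k

lemma eq_range (hP : IsPeriodicOrbit f n P) (hx : x ∈ P) : P = range fun k : ℕ => f^[k] x := by
  ext y
  refine ⟨fun hy => ?_, ?_⟩
  · obtain ⟨k, -, rfl⟩ := hP.exists_lt_iterate_eq hx hy
    exact mem_range_self k
  · rintro ⟨k, rfl⟩
    exact hP.iterate_mem hx k

lemma finite (hP : IsPeriodicOrbit f n P) : P.Finite := by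
  obtain ⟨x, hx⟩ := hP.nonempty
  rw [hP.eq_image hx]
  exact (finite_Iio n).image _

lemma ncard_eq (hP : IsPeriodicOrbit f n P) : P.ncard = n := by
  obtain ⟨x, hx⟩ := hP.nonempty
  have hinj : InjOn (f^[·] x) (Iio n) :=
    hP.minimalPeriod_eq hx ▸ iterate_injOn_Iio_minimalPeriod
  rw [hP.eq_image hx, hinj.ncard_image, ncard_Iio_nat]

variable [ConditionallyCompleteLinearOrder α]

lemma csInf_mem (hP : IsPeriodicOrbit f n P) : sInf P ∈ P :=
  hP.nonempty.csInf_mem hP.finite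

lemma csSup_mem (hP : IsPeriodicOrbit f n P) : sSup P ∈ P :=
  hP.nonempty.csSup_mem hP.finite

lemma subset_Icc (hP : IsPeriodicOrbit f n P) : P ⊆ Icc (sInf P) (sSup P) :=
  subset_Icc_csInf_csSup hP.finite.bddBelow hP.finite.bddAbove

lemma csInf_le_csSup (hP : IsPeriodicOrbit f n P) : sInf P ≤ sSup P :=
  (hP.subset_Icc hP.csInf_mem).2

end IsPeriodicOrbit

end PeriodicOrbits

/-- Two neighbouring points `a < b` of `P` that `f` moves towards each other, with a fixed point
`c` of `f` between them. -/
structure IsCenter [Preorder α] (f : α → α) (P : Set α) (a c b : α) : Prop where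
  left_mem : a ∈ P
  right_mem : b ∈ P
  left_lt : a < c
  lt_right : c < b
  isFixedPt : IsFixedPt f c
  le_apply_left : b ≤ f a
  apply_right_le : f b ≤ a
  le_or_le : ∀ x ∈ P, x ≤ a ∨ b ≤ x

/-- The points `x` and `f x` lie strictly on different sides of `c`. -/
def SwitchesSides [Preorder α] (f : α → α) (c x : α) : Prop :=
  x < c ∧ c < f x ∨ c < x ∧ f x < c

/-- The horseshoe-like configuration `f w ≤ u < v < c = f c < w ≤ f v`, `f u ≤ c`, by which `f`
has all even periods. -/
structure IsTwist [Preorder α] (f : α → α) (c u v w : α) : Prop where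
  isFixedPt : IsFixedPt f c
  u_lt_v : u < v
  v_lt_c : v < c
  c_lt_w : c < w
  apply_w_le : f w ≤ u
  le_apply_v : w ≤ f v
  apply_u_le : f u ≤ c

section Centers

lemma IsCenter.dual [Preorder α] {f : α → α} {P : Set α} {a b c : α} (h : IsCenter f P a c b) :
    IsCenter (α := αᵒᵈ) f P b c a where
  left_mem := h.right_mem
  right_mem := h.left_mem
  left_lt := h.lt_right
  lt_right := h.left_lt
  isFixedPt := h.isFixedPt
  le_apply_left := h.apply_right_le
  apply_right_le := h.le_apply_left
  le_or_le x hx := (h.le_or_le x hx).symm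

lemma IsCenter.notMem [Preorder α] {f : α → α} {P : Set α} {a b c : α} (h : IsCenter f P a c b) :
    c ∉ P :=
  fun hc => (h.le_or_le c hc).elim h.left_lt.not_ge h.lt_right.not_ge

lemma IsPeriodicOrbit.exists_neighbours [LinearOrder α] {f : α → α} {n : ℕ} {P : Set α}
    (hP : IsPeriodicOrbit f n P) (hn : 2 ≤ n) :
    ∃ a ∈ P, ∃ b ∈ P, a < b ∧ b ≤ f a ∧ f b ≤ a ∧ ∀ x ∈ P, x ≤ a ∨ b ≤ x := by
  have hne {x : α} (hx : x ∈ P) : f x ≠ x := hP.not_isFixedPt (by lia) hx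
  obtain ⟨z, hz, hzmin⟩ := exists_min_image P id hP.finite hP.nonempty
  have hz' : z < f z := (hzmin _ (hP.apply_mem hz)).lt_of_ne (hne hz).symm
  obtain ⟨a, ⟨ha, haf⟩, hamax⟩ :=
    exists_max_image {x ∈ P | x < f x} id (hP.finite.sep _) ⟨z, hz, hz'⟩
  obtain ⟨b, ⟨hb, hab⟩, hbmin⟩ :=
    exists_min_image {x ∈ P | a < x} id (hP.finite.sep _) ⟨f a, hP.apply_mem ha, haf⟩
  have hgap (x) (hx : x ∈ P) : x ≤ a ∨ b ≤ x := (le_or_gt x a).imp_right fun h => hbmin x ⟨hx, h⟩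
  have hfb : f b < b := (hne hb).lt_of_le (not_lt.1 fun h => (hamax b ⟨hb, h⟩).not_gt hab)
  exact ⟨a, ha, b, hb, hab, hbmin _ ⟨hP.apply_mem ha, haf⟩,
    (hgap _ (hP.apply_mem hb)).resolve_right hfb.not_ge, hgap⟩

variable [ConditionallyCompleteLinearOrder α] [TopologicalSpace α] [OrderTopology α]
  [DenselyOrdered α] {f : α → α} {P : Set α} {a b c : α} {m n : ℕ}

lemma IsPeriodicOrbit.exists_isCenter (hP : IsPeriodicOrbit f n P) (hf : Continuous f)
    (hn : 2 ≤ n) : ∃ a c b, IsCenter f P a c b := by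
  obtain ⟨a, ha, b, hb, hab, hfa, hfb, hgap⟩ := hP.exists_neighbours hn
  obtain ⟨c, hc, hfc⟩ :=
    exists_mem_Icc_isFixedPt hf.continuousOn hab.le (hab.le.trans hfa) (hfb.trans hab.le)
  have hne {x : α} (hx : x ∈ P) : x ≠ c := by
    rintro rfl
    exact hP.not_isFixedPt (by lia) hx hfc
  exact ⟨a, c, b, ha, hb, hc.1.lt_of_ne (hne ha), hc.2.lt_of_ne (hne hb).symm, hfc, hfa, hfb, hgap⟩

lemma one_mem_periods (hf : Continuous f) (hn : n ∈ periods f) : 1 ∈ periods f := by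
  obtain rfl | h : n = 1 ∨ 2 ≤ n := by have := hn.1; lia
  · exact hn
  · obtain ⟨P, hP⟩ := mem_periods_iff_exists_isPeriodicOrbit.1 hn
    obtain ⟨a, c, b, hc⟩ := hP.exists_isCenter hf h
    exact one_mem_periods_of_isFixedPt hc.isFixedPt

lemma IsTwist.exists_isPeriodicPt {u v w : α} (h : IsTwist f c u v w) (hf : Continuous f) (j : ℕ) :
    ∃ x, IsPeriodicPt f (2 * j) x ∧ ∀ i ≤ 2 * j,
      f^[i] x ∈ if Even i then Icc c w else if i = 1 then Icc u v else Icc v c := by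
  obtain ⟨hc, huv, hvc, hcw, hfw, hfv, hfu⟩ := h
  let K (i : ℕ) : Set α := if Even i then Icc c w else if i = 1 then Icc u v else Icc v c
  have hK (i : ℕ) : (K i).OrdConnected := by
    simp only [K]
    split_ifs <;> exact ordConnected_Icc
  have hcov (i : ℕ) (_ : i < 2 * j) : SurjOn f (K i) (K (i + 1)) := by
    rcases Nat.even_or_odd i with hi | hi
    · have hsub : K (i + 1) ⊆ uIcc (f w) (f c) := by
        grind [IsFixedPt, uIcc_of_le]
      exact (hf.continuousOn.surjOn_uIcc (by grind) (by grind)).mono subset_rfl hsub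
    · have hKsucc : K (i + 1) = Icc c w := if_pos hi.add_one
      obtain ⟨y, hy, hfy⟩ : ∃ y ∈ K i, f y ≤ c := by
        by_cases h1 : i = 1
        · exact ⟨u, by grind, hfu⟩
        · exact ⟨c, by grind, hc.le⟩
      rw [hKsucc]
      exact (hf.continuousOn.surjOn_Icc hy (show v ∈ K i by grind)).mono subset_rfl
        (Icc_subset_Icc hfy hfv)
  obtain ⟨x, hx, hxK⟩ := exists_isPeriodicPt_of_loop hf hK hcov (r := c) (s := w)
    (by grind) (by grind) subset_rfl
  exact ⟨x, hx, hxK⟩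

lemma IsTwist.two_mul_mem_periods {u v w : α} (h : IsTwist f c u v w) (hf : Continuous f) {j : ℕ}
    (hj : 0 < j) : 2 * j ∈ periods f := by
  obtain ⟨x, hx, hxK⟩ := h.exists_isPeriodicPt hf j
  obtain ⟨hc, huv, hvc, hcw, hfw, hfv, hfu⟩ := h
  have heven {i : ℕ} (hij : i ≤ 2 * j) (hi : Even i) : f^[i] x ∈ Icc c w := by grind
  have hodd {i : ℕ} (hij : i ≤ 2 * j) (hi : Odd i) (h1 : i ≠ 1) : f^[i] x ∈ Icc v c := by grind
  have hx0 : x ∈ Icc c w := heven (Nat.zero_le _) Even.zero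
  have hx1 : f x ∈ Icc u v := hxK 1 (by lia)
  refine mem_periods_of_forall_not_isPeriodicPt (by lia) hx fun d hd0 hdj hd => ?_
  rcases Nat.even_or_odd d with hde | hdo
  · have hfx : f x ∈ Icc v c := by
      have := hodd hdj hde.add_one (by lia)
      rwa [iterate_succ_apply' f, hd.eq] at this
    have hfx_eq : f x = v := hx1.2.antisymm hfx.1
    have hffx : f v ∈ Icc c w := by
      rw [← hfx_eq]
      exact heven (i := 2) (by lia) even_two
    have hf3x : f w ∈ Icc v c := by
      have := hodd (i := 3) (by grind) (by decide) (by decide)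
      rwa [iterate_succ_apply', iterate_succ_apply', iterate_one, hfx_eq,
        ← hfv.antisymm hffx.2] at this
    order [hf3x.1]
  · have hxd : f^[d] x ∈ Icc u c := by grind
    obtain rfl : x = c := (hd.eq ▸ hxd).2.antisymm hx0.1
    order [hx1.2, hc.eq]

end Centers

/-- Bounds `s < c < t` such that every point of `P` in `[s, t]` switches sides about `c`, some point
of `P ∩ [s, c)` is mapped to or beyond `t`, and some point of `P ∩ (c, t]` to or below `s`. -/
structure IsSwitchingBlock [Preorder α] (f : α → α) (P : Set α) (c s t : α) : Prop where
  switchesSides : ∀ x ∈ P, x ∈ Icc s t → SwitchesSides f c x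
  exists_le_apply : ∃ v ∈ P, v ∈ Ico s c ∧ t ≤ f v
  exists_apply_le : ∃ w ∈ P, w ∈ Ioc c t ∧ f w ≤ s

section Switching

lemma IsCenter.isSwitchingBlock [PartialOrder α] {f : α → α} {P : Set α} {a b c : α}
    (h : IsCenter f P a c b) : IsSwitchingBlock f P c a b where
  switchesSides x hx hxab := by
    rcases h.le_or_le x hx with hxa | hbx
    · obtain rfl : x = a := hxa.antisymm hxab.1
      exact .inl ⟨h.left_lt, h.lt_right.trans_le h.le_apply_left⟩
    · obtain rfl : x = b := hxab.2.antisymm hbx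
      exact .inr ⟨h.lt_right, h.apply_right_le.trans_lt h.left_lt⟩
  exists_le_apply := ⟨a, h.left_mem, ⟨le_rfl, h.left_lt⟩, h.le_apply_left⟩
  exists_apply_le := ⟨b, h.right_mem, ⟨h.lt_right, le_rfl⟩, h.apply_right_le⟩

variable [LinearOrder α] {f : α → α} {P : Set α} {a b c s t : α} {n : ℕ}

/- The new block is spanned by the lowest and the highest image of the old one. A point that it
adds without switching sides would be the point `u` of a twist. -/
lemma IsSwitchingBlock.exists_mapsTo (h : IsSwitchingBlock f P c s t) (hfin : P.Finite)
    (hc : IsFixedPt f c) (htwist : ∀ u v w, ¬IsTwist f c u v w)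
    (htwist' : ∀ u v w, ¬IsTwist (α := αᵒᵈ) f c u v w) :
    ∃ s' t', IsSwitchingBlock f P c s' t' ∧ MapsTo f (P ∩ Icc s t) (Icc s' t') := by
  obtain ⟨hsw, ⟨v, hv, hvI, hvt⟩, ⟨w, hw, hwI, hws⟩⟩ := h
  obtain ⟨v', ⟨hv', hv'I⟩, hmax⟩ :=
    exists_max_image (P ∩ Ico s c) f (hfin.inter_of_left _) ⟨v, hv, hvI⟩
  obtain ⟨w', ⟨hw', hw'I⟩, hmin⟩ :=
    exists_min_image (P ∩ Ioc c t) f (hfin.inter_of_left _) ⟨w, hw, hwI⟩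
  have hw's : f w' ≤ s := (hmin w ⟨hw, hwI⟩).trans hws
  have htv' : t ≤ f v' := hvt.trans (hmax v ⟨hv, hvI⟩)
  refine ⟨f w', f v', ⟨fun x hx hxI => ?_, ⟨v', hv', ⟨hw's.trans hv'I.1, hv'I.2⟩, le_rfl⟩,
    ⟨w', hw', ⟨hw'I.1, hw'I.2.trans htv'⟩, le_rfl⟩⟩, fun x ⟨hx, hxI⟩ => ?_⟩
  · by_cases hxs : x < s
    · refine .inl ⟨hxs.trans_le (hvI.1.trans hvI.2.le), lt_of_not_ge fun hfx => ?_⟩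
      exact htwist x v w' ⟨hc, hxs.trans_le hvI.1, hvI.2, hw'I.1, hxI.1, hw'I.2.trans hvt, hfx⟩
    by_cases hxt : t < x
    · refine .inr ⟨(hwI.1.trans_le hwI.2).trans hxt, lt_of_not_ge fun hfx => ?_⟩
      exact htwist' x w v' ⟨hc, hwI.2.trans_lt hxt, hwI.1, hv'I.2, hxI.2, hws.trans hv'I.1, hfx⟩
    exact hsw x hx ⟨not_lt.1 hxs, not_lt.1 hxt⟩
  · rcases hsw x hx hxI with ⟨hxc, hcf⟩ | ⟨hcx, hfc⟩
    · exact ⟨hw's.trans (hxI.1.trans (hxc.trans hcf).le), hmax x ⟨hx, hxI.1, hxc⟩⟩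
    · exact ⟨hmin x ⟨hx, hcx, hxI.2⟩, (hfc.trans hcx).le.trans (hxI.2.trans htv')⟩

lemma IsPeriodicOrbit.forall_switchesSides (hP : IsPeriodicOrbit f n P) (hc : IsCenter f P a c b)
    (htwist : ∀ u v w, ¬IsTwist f c u v w) (htwist' : ∀ u v w, ¬IsTwist (α := αᵒᵈ) f c u v w) :
    ∀ x ∈ P, SwitchesSides f c x := by
  have hblock (k : ℕ) : ∃ s t, IsSwitchingBlock f P c s t ∧ f^[k] a ∈ Icc s t := by
    induction k with
    | zero => exact ⟨a, b, hc.isSwitchingBlock, le_rfl, (hc.left_lt.trans hc.lt_right).le⟩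
    | succ k ih =>
      obtain ⟨s, t, hst, hmem⟩ := ih
      obtain ⟨s', t', hst', hmaps⟩ := hst.exists_mapsTo hP.finite hc.isFixedPt htwist htwist'
      rw [iterate_succ_apply']
      exact ⟨s', t', hst', hmaps ⟨hP.iterate_mem hc.left_mem k, hmem⟩⟩
  intro x hx
  obtain ⟨k, -, rfl⟩ := hP.exists_lt_iterate_eq hc.left_mem hx
  obtain ⟨s, t, hst, hmem⟩ := hblock k
  exact hst.switchesSides _ hx hmem

lemma IsPeriodicOrbit.even_of_forall_switchesSides (hP : IsPeriodicOrbit f n P)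
    (hsw : ∀ x ∈ P, SwitchesSides f c x) : Even n := by
  have hleft : MapsTo f (P ∩ Iio c) (P ∩ Ioi c) := fun x ⟨hx, hxc⟩ =>
    ⟨hP.apply_mem hx, ((hsw x hx).resolve_right fun h => h.1.not_gt hxc).2⟩
  have hright : MapsTo f (P ∩ Ioi c) (P ∩ Iio c) := fun x ⟨hx, hxc⟩ =>
    ⟨hP.apply_mem hx, ((hsw x hx).resolve_left fun h => h.1.not_gt hxc).2⟩
  have hcard : (P ∩ Iio c).ncard = (P ∩ Ioi c).ncard :=
    (ncard_le_ncard_of_injOn f hleft (hP.injOn.mono inter_subset_left)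
      (hP.finite.inter_of_left _)).antisymm
      (ncard_le_ncard_of_injOn f hright (hP.injOn.mono inter_subset_left)
      (hP.finite.inter_of_left _))
  have hunion : P ∩ Iio c ∪ P ∩ Ioi c = P := by
    rw [← inter_union_distrib_left, inter_eq_left]
    exact fun x hx => (hsw x hx).imp And.left And.left
  have hdisj : Disjoint (P ∩ Iio c) (P ∩ Ioi c) :=
    disjoint_left.2 fun x hx hx' => hx.2.not_gt hx'.2
  rw [← hP.ncard_eq, ← hunion, ncard_union_eq hdisj (hP.finite.inter_of_left _)
    (hP.finite.inter_of_left _), hcard]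
  exact ⟨_, rfl⟩

end Switching

section EvenPeriods

variable [ConditionallyCompleteLinearOrder α] [TopologicalSpace α] [OrderTopology α]
  [DenselyOrdered α] {f : α → α} {P : Set α} {a b c : α} {m n : ℕ}

lemma IsPeriodicOrbit.switchesSides_or_two_mul_mem_periods (hP : IsPeriodicOrbit f n P)
    (hf : Continuous f) (hc : IsCenter f P a c b) :
    (∀ x ∈ P, SwitchesSides f c x) ∨ ∀ j, 0 < j → 2 * j ∈ periods f := by
  by_contra! ⟨hsw, j, hj, hjf⟩
  obtain ⟨x, hx, hxsw⟩ := hsw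
  exact hxsw <| hP.forall_switchesSides hc (fun u v w h => hjf (h.two_mul_mem_periods hf hj))
    (fun u v w h => hjf (h.two_mul_mem_periods hf hj)) x hx

lemma IsPeriodicOrbit.two_mem_periods_of_forall_switchesSides (hP : IsPeriodicOrbit f n P)
    (hf : Continuous f) (hc : IsCenter f P a c b) (hsw : ∀ x ∈ P, SwitchesSides f c x) :
    2 ∈ periods f := by
  have hmem {x : α} (hx : x ∈ P) : x ∈ Icc (sInf P) (sSup P) := hP.subset_Icc hx
  have hleft {x : α} (hx : x ∈ P) (hfx : b ≤ f x) : x ∈ Icc (sInf P) a := by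
    have hxc := (hsw x hx).resolve_right fun h => h.2.not_gt (hc.lt_right.trans_le hfx)
    exact ⟨(hmem hx).1, (hc.le_or_le x hx).resolve_right (hxc.1.trans hc.lt_right).not_ge⟩
  have hright {x : α} (hx : x ∈ P) (hfx : f x ≤ a) : x ∈ Icc b (sSup P) := by
    have hcx := (hsw x hx).resolve_left fun h => h.2.not_gt (hfx.trans_lt hc.left_lt)
    exact ⟨(hc.le_or_le x hx).resolve_left (hc.left_lt.trans hcx.1).not_ge, (hmem hx).2⟩
  have hLR : SurjOn f (Icc (sInf P) a) (Icc b (sSup P)) := by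
    obtain ⟨x, hx, hfx⟩ := hP.exists_apply_eq hc.right_mem
    obtain ⟨y, hy, hfy⟩ := hP.exists_apply_eq hP.csSup_mem
    simpa only [hfx, hfy] using hf.continuousOn.surjOn_Icc (hleft hx hfx.ge)
      (hleft hy (hfy.symm ▸ (hmem hc.right_mem).2))
  have hRL : SurjOn f (Icc b (sSup P)) (Icc (sInf P) a) := by
    obtain ⟨x, hx, hfx⟩ := hP.exists_apply_eq hc.left_mem
    obtain ⟨y, hy, hfy⟩ := hP.exists_apply_eq hP.csInf_mem
    simpa only [hfx, hfy] using hf.continuousOn.surjOn_Icc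
      (hright hy (hfy.symm ▸ (hmem hc.left_mem).1)) (hright hx hfx.le)
  let K (i : ℕ) : Set α := if Even i then Icc (sInf P) a else Icc b (sSup P)
  obtain ⟨x, hx, hxK⟩ := exists_isPeriodicPt_of_loop hf (K := K) (n := 2)
    (fun i => by simp only [K]; split_ifs <;> exact ordConnected_Icc) (fun i _ => by grind)
    (left_mem_Icc.2 (hmem hc.left_mem).1) (right_mem_Icc.2 (hmem hc.left_mem).1) subset_rfl
  refine mem_periods_of_forall_not_isPeriodicPt two_pos hx fun d hd0 hd2 hd => ?_
  obtain rfl : d = 1 := by lia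
  have h0 : x ∈ Icc (sInf P) a := hxK 0 (by lia)
  have h1 : f x ∈ Icc b (sSup P) := hxK 1 (by lia)
  have hfx : f x = x := hd
  order [h0.2, h1.1, hc.left_lt, hc.lt_right]

lemma two_mem_periods (hf : Continuous f) (hn : n ∈ periods f) (h2 : 2 ≤ n) : 2 ∈ periods f := by
  obtain ⟨P, hP⟩ := mem_periods_iff_exists_isPeriodicOrbit.1 hn
  obtain ⟨a, c, b, hc⟩ := hP.exists_isCenter hf h2
  obtain hsw | heven := hP.switchesSides_or_two_mul_mem_periods hf hc
  · exact hP.two_mem_periods_of_forall_switchesSides hf hc hsw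
  · exact heven 1 one_pos

end EvenPeriods

section OddPeriods

variable [ConditionallyCompleteLinearOrder α] [TopologicalSpace α] [OrderTopology α]
  [DenselyOrdered α] {f : α → α} {P : Set α} {a b c u : α} {m n : ℕ}

/- The loop `[u, a] → s → ⋯ → s → f '' s → ⋯ → f^[n] '' s ∋ u, a`, with `t` copies of `s`. -/
lemma exists_isPeriodicPt_of_surjOn {s : Set α} (hs : s.OrdConnected) (hf : Continuous f)
    (hss : SurjOn f s s) (hus : SurjOn f (Icc u a) s) (hu : u ∈ f^[n] '' s) (ha : a ∈ f^[n] '' s)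
    {t : ℕ} (ht : 0 < t) :
    ∃ x ∈ Icc u a, IsPeriodicPt f (t + n) x ∧ ∀ i, 0 < i → i ≤ t → f^[i] x ∈ s := by
  let K (i : ℕ) : Set α := if i = 0 then Icc u a else f^[i - t] '' s
  have hK (i : ℕ) : (K i).OrdConnected := by
    simp only [K]
    split_ifs
    · exact ordConnected_Icc
    · exact (hs.isPreconnected.image _ (hf.iterate _).continuousOn).ordConnected
  have hKs {i : ℕ} (h0 : 0 < i) (hi : i ≤ t) : K i = s := by
    simp [K, h0.ne', Nat.sub_eq_zero_of_le hi]
  have hcov (i : ℕ) (_ : i < t + n) : SurjOn f (K i) (K (i + 1)) := by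
    rcases i.eq_zero_or_pos with rfl | h0
    · exact (hKs one_pos ht).symm ▸ hus
    rcases lt_or_ge i t with hit | hti
    · rwa [hKs h0 hit.le, hKs i.succ_pos hit]
    · have himage : f '' K i = K (i + 1) := by
        simp only [K, h0.ne', if_false, i.succ_ne_zero, Nat.sub_add_comm hti, image_image,
          iterate_succ_apply']
      exact himage.superset
  have hKn : K (t + n) = f^[n] '' s := by simp [K, ht.ne']
  obtain ⟨x, hx, hxK⟩ := exists_isPeriodicPt_of_loop hf hK hcov (hKn ▸ hu) (hKn ▸ ha) subset_rfl
  refine ⟨x, hxK 0 (Nat.zero_le _), hx, fun i h0 hi => ?_⟩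
  exact hKs h0 hi ▸ hxK i (by lia)

lemma IsCenter.surjOn_Icc (hc : IsCenter f P a c b) (hf : Continuous f) :
    SurjOn f (Icc a b) (Icc a b) := by
  have hab : a ≤ b := (hc.left_lt.trans hc.lt_right).le
  rw [← uIcc_of_le hab]
  refine (hf.continuousOn.surjOn_uIcc left_mem_uIcc right_mem_uIcc).mono subset_rfl ?_
  rw [uIcc_of_le hab, uIcc_of_ge (hc.apply_right_le.trans (hab.trans hc.le_apply_left))]
  exact Icc_subset_Icc hc.apply_right_le hc.le_apply_left

lemma IsPeriodicOrbit.exists_isPeriodicPt_mem_Icc (hP : IsPeriodicOrbit f m P) (hf : Continuous f)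
    (hc : IsCenter f P a c b) (hu : u ∈ P) (huc : u < c) (hfu : f u ≤ c) {l : ℕ} (hml : m ≤ l) :
    ∃ x ∈ Icc u a, IsPeriodicPt f l x ∧ ∀ i, 0 < i → i + m ≤ l + 1 → f^[i] x ∈ Icc a b := by
  have hua : u ≤ a := (hc.le_or_le u hu).resolve_right (huc.trans hc.lt_right).not_ge
  have hfua : f u ≤ a :=
    (hc.le_or_le _ (hP.apply_mem hu)).resolve_right (hfu.trans_lt hc.lt_right).not_ge
  have hus : SurjOn f (Icc u a) (Icc a b) :=
    (hf.continuousOn.surjOn_Icc (left_mem_Icc.2 hua) (right_mem_Icc.2 hua)).mono subset_rfl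
      (Icc_subset_Icc hfua hc.le_apply_left)
  have himage {x : α} (hx : x ∈ P) : x ∈ f^[m - 1] '' Icc a b := by
    obtain ⟨k, hk, rfl⟩ := hP.exists_lt_iterate_eq hc.left_mem hx
    obtain ⟨y, hy, hya⟩ := (hc.surjOn_Icc hf).iterate (m - 1 - k)
      (left_mem_Icc.2 (hc.left_lt.trans hc.lt_right).le)
    exact ⟨y, hy, by rw [← hya, ← iterate_add_apply]; congr 2; lia⟩
  have hm := hP.1
  obtain ⟨t, rfl⟩ : ∃ t, l = t + (m - 1) := ⟨l - (m - 1), by lia⟩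
  obtain ⟨x, hx, hxl, hxs⟩ := exists_isPeriodicPt_of_surjOn ordConnected_Icc hf (hc.surjOn_Icc hf)
    hus (himage hu) (himage hc.left_mem) (t := t) (by lia)
  exact ⟨x, hx, hxl, fun i h0 hi => hxs i h0 (by lia)⟩

lemma IsPeriodicOrbit.mem_periods_or_exists_odd_lt (hP : IsPeriodicOrbit f m P) (hf : Continuous f)
    (hc : IsCenter f P a c b) (hm : Odd m) (hu : u ∈ P) (huc : u < c) (hfu : f u ≤ c) {l : ℕ}
    (hl : Odd l) (hml : m < l) :
    l ∈ periods f ∨ ∃ d < m, 1 < d ∧ Odd d ∧ d ∈ periods f := by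
  obtain ⟨x, hx, hxl, hxI⟩ := hP.exists_isPeriodicPt_mem_Icc hf hc hu huc hfu hml.le
  generalize hd : minimalPeriod f x = d
  obtain ⟨e, rfl⟩ : d ∣ l := hd ▸ hxl.minimalPeriod_dvd
  obtain ⟨hdo, heo⟩ := Nat.odd_mul.1 hl
  obtain rfl | he : e = 1 ∨ 3 ≤ e := by grind
  · exact .inl (by simpa only [mul_one] using ⟨hdo.pos, x, hd⟩)
  have h3d : d * 3 ≤ d * e := Nat.mul_le_mul_left d he
  have hm1 : m ≠ 1 := by
    rintro rfl
    have hfa : f a = a := hP.iterate_eq_self hc.left_mem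
    order [hc.left_lt, hc.lt_right, hc.le_apply_left]
  rcases lt_or_ge (d * e + 1) (d + m) with hlt | hge
  · exact .inr ⟨d, by lia, by lia, hdo, hdo.pos, x, hd⟩
  exfalso
  have hxI' : x ∈ Icc a b := (hd ▸ iterate_minimalPeriod : f^[d] x = x) ▸ hxI d hdo.pos hge
  obtain rfl : x = a := hx.2.antisymm hxI'.1
  obtain rfl : m = d := (hP.minimalPeriod_eq hc.left_mem).symm.trans hd
  have hfx : f x = b := (hxI 1 one_pos (by lia)).2.antisymm hc.le_apply_left
  have hffx : f^[2] x = x := (hfx ▸ hc.apply_right_le : f (f x) ≤ x).antisymm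
    (hxI 2 two_pos (by lia)).1
  have hm2 : m ≤ 2 := hd ▸ IsPeriodicPt.minimalPeriod_le two_pos hffx
  grind

lemma odd_mem_periods (hf : Continuous f) (hm : m ∈ periods f) (hmo : Odd m) (hm1 : 1 < m) {l : ℕ}
    (hl : Odd l) (hml : m < l) : l ∈ periods f := by
  induction m using Nat.strong_induction_on with
  | h m ih =>
    suffices h : l ∈ periods f ∨ ∃ d < m, 1 < d ∧ Odd d ∧ d ∈ periods f from
      h.elim id fun ⟨d, hdm, hd1, hdo, hd⟩ => ih d hdm hd hdo hd1 (hdm.trans hml)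
    obtain ⟨P, hP⟩ := mem_periods_iff_exists_isPeriodicOrbit.1 hm
    obtain ⟨a, c, b, hc⟩ := hP.exists_isCenter hf hm1
    obtain ⟨u, hu, hsw⟩ : ∃ u ∈ P, ¬SwitchesSides f c u := by
      by_contra! h
      exact Nat.not_even_iff_odd.2 hmo (hP.even_of_forall_switchesSides h)
    have huc : u ≠ c := fun h => hc.notMem (h ▸ hu)
    rcases huc.lt_or_gt with huc | hcu
    · exact hP.mem_periods_or_exists_odd_lt hf hc hmo hu huc
        (not_lt.1 fun h => hsw (.inl ⟨huc, h⟩)) hl hml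
    · exact IsPeriodicOrbit.mem_periods_or_exists_odd_lt (α := αᵒᵈ) hP hf hc.dual hmo hu hcu
        (not_lt.1 fun h => hsw (.inr ⟨hcu, h⟩)) hl hml

lemma even_mem_periods (hf : Continuous f) (hm : m ∈ periods f) (hmo : Odd m) (hm1 : 1 < m) {j : ℕ}
    (hj : 0 < j) : 2 * j ∈ periods f := by
  obtain ⟨P, hP⟩ := mem_periods_iff_exists_isPeriodicOrbit.1 hm
  obtain ⟨a, c, b, hc⟩ := hP.exists_isCenter hf hm1
  refine (hP.switchesSides_or_two_mul_mem_periods hf hc).resolve_left (fun h => ?_) j hj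
  exact Nat.not_even_iff_odd.2 hmo (hP.even_of_forall_switchesSides h)

end OddPeriods
section Iterates

variable {f : α → α} {a k e : ℕ}

lemma mem_periods_iterate_iff (hk : 0 < k) :
    e ∈ periods f^[k] ↔ ∃ i j, k = i * j ∧ i.Coprime e ∧ j * e ∈ periods f := by
  constructor
  · rintro ⟨he, x, rfl⟩
    rw [minimalPeriod_iterate_eq_div_gcd hk.ne'] at he ⊢
    have hN : 0 < minimalPeriod f x := Nat.pos_of_div_pos he
    have hj : 0 < (minimalPeriod f x).gcd k := Nat.gcd_pos_of_pos_right _ hk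
    refine ⟨k / (minimalPeriod f x).gcd k, (minimalPeriod f x).gcd k,
      (Nat.div_mul_cancel (Nat.gcd_dvd_right _ _)).symm,
      (Nat.coprime_div_gcd_div_gcd hj).symm, ?_⟩
    rw [Nat.mul_div_cancel' (Nat.gcd_dvd_left _ _)]
    exact ⟨hN, x, rfl⟩
  · rintro ⟨i, j, rfl, hie, hje, x, hx⟩
    have hj : 0 < j := Nat.pos_of_mul_pos_left hk
    have hgcd : (j * e).gcd (i * j) = j := by
      rw [mul_comm i, Nat.gcd_mul_left, hie.symm.gcd_eq_one, mul_one]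
    refine ⟨Nat.pos_of_mul_pos_left hje, x, ?_⟩
    rw [minimalPeriod_iterate_eq_div_gcd hk.ne', hx, hgcd, Nat.mul_div_cancel_left _ hj]

lemma mem_periods_iterate (h : k * e ∈ periods f) : e ∈ periods f^[k] :=
  (mem_periods_iterate_iff (Nat.pos_of_mul_pos_right h.1)).2
    ⟨1, k, (one_mul k).symm, Nat.coprime_one_left e, h⟩

lemma exists_two_pow_mul_mem_periods (h : e ∈ periods f^[2 ^ a]) :
    ∃ j ≤ a, 2 ^ j * e ∈ periods f := by
  obtain ⟨i, j, hij, -, hj⟩ := (mem_periods_iterate_iff (by positivity)).1 h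
  obtain ⟨l, hl, rfl⟩ := (Nat.dvd_prime_pow Nat.prime_two).1 (Dvd.intro_left i hij.symm)
  exact ⟨l, hl, hj⟩

lemma two_pow_mul_mem_periods_of_even (h : e ∈ periods f^[2 ^ a]) (he : Even e) :
    2 ^ a * e ∈ periods f := by
  obtain ⟨i, j, hij, hie, hj⟩ := (mem_periods_iterate_iff (by positivity)).1 h
  obtain ⟨l, -, rfl⟩ := (Nat.dvd_prime_pow Nat.prime_two).1 (Dvd.intro j hij.symm)
  have hl : l = 0 := by
    by_contra hl
    exact Nat.not_even_iff_odd.2 (Nat.coprime_two_left.1 ((Nat.coprime_pow_left_iff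
      (Nat.pos_of_ne_zero hl) _ _).1 hie)) he
  rwa [hij, hl, pow_zero, one_mul]

end Iterates

section Forcing

variable [ConditionallyCompleteLinearOrder α] [TopologicalSpace α] [OrderTopology α]
  [DenselyOrdered α] {f : α → α} {a b p q m n : ℕ}

lemma two_pow_mul_mem_periods_of_lt (hf : Continuous f) (hm : 2 ^ a * p ∈ periods f)
    (hp : Odd p) (hp1 : 1 < p) (hab : a < b) (hq : 0 < q) : 2 ^ b * q ∈ periods f := by
  obtain ⟨c, rfl⟩ := Nat.exists_eq_add_of_lt hab
  rw [show 2 ^ (a + c + 1) * q = 2 ^ a * (2 * (2 ^ c * q)) by ring]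
  exact two_pow_mul_mem_periods_of_even
    (even_mem_periods (hf.iterate _) (mem_periods_iterate hm) hp hp1 (by positivity))
    (even_two_mul _)

lemma two_pow_mul_mem_periods_of_odd (hf : Continuous f) (hm : 2 ^ a * p ∈ periods f)
    (hp : Odd p) (hp1 : 1 < p) (hq : Odd q) (hpq : p < q) : 2 ^ a * q ∈ periods f := by
  obtain ⟨j, hj, hjq⟩ := exists_two_pow_mul_mem_periods
    (odd_mem_periods (hf.iterate _) (mem_periods_iterate hm) hp hp1 hq hpq)
  obtain rfl | hlt := hj.eq_or_lt
  · exact hjq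
  · exact two_pow_mul_mem_periods_of_lt hf hjq hq (hp1.trans hpq) hlt hq.pos

lemma two_pow_mem_periods_of_lt (hf : Continuous f) (hm : 2 ^ a ∈ periods f) (hba : b < a) :
    2 ^ b ∈ periods f := by
  cases b with
  | zero => exact one_mem_periods hf hm
  | succ b =>
    rw [← Nat.add_sub_cancel' (by lia : b ≤ a), pow_add] at hm
    rw [pow_succ]
    exact two_pow_mul_mem_periods_of_even (two_mem_periods (hf.iterate _)
      (mem_periods_iterate hm) (Nat.le_self_pow (by lia) 2)) even_two

theorem mem_periods_of_prec (hf : Continuous f) (hm : m ∈ periods f) (h : Prec m n) :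
    n ∈ periods f := by
  obtain ⟨a, p, b, q, hp, hq, rfl, rfl,
    ⟨hp1, -, hab | ⟨rfl, hpq⟩⟩ | ⟨hp1, rfl⟩ | ⟨rfl, rfl, hba⟩⟩ := h
  · exact two_pow_mul_mem_periods_of_lt hf hm hp hp1 hab hq.pos
  · exact two_pow_mul_mem_periods_of_odd hf hm hp hp1 hq hpq
  · have hmax : 2 ^ (max a b + 1) ∈ periods f := by
      simpa only [mul_one] using
        two_pow_mul_mem_periods_of_lt hf hm hp hp1 (by lia : a < max a b + 1) one_pos
    rw [mul_one]
    exact two_pow_mem_periods_of_lt hf hmax (by lia)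
  · rw [mul_one] at hm ⊢
    exact two_pow_mem_periods_of_lt hf hm hba

end Forcing

section Ordering

variable {a b m n p q : ℕ} {S : Set ℕ}

lemma two_pow_mul_odd_inj (hp : Odd p) (hq : Odd q) :
    2 ^ a * p = 2 ^ b * q ↔ a = b ∧ p = q := by
  have val : ∀ c r : ℕ, Odd r → padicValNat 2 (2 ^ c * r) = c := fun c r hr => by
    rw [padicValNat.mul (by positivity) hr.pos.ne', padicValNat.prime_pow,
      padicValNat.eq_zero_of_not_dvd hr.not_two_dvd_nat, add_zero]
  constructor
  · intro h
    obtain rfl : a = b := by rw [← val a p hp, h, val b q hq]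
    exact ⟨rfl, Nat.eq_of_mul_eq_mul_left (by positivity) h⟩
  · rintro ⟨rfl, rfl⟩
    rfl

lemma prec_iff (hp : Odd p) (hq : Odd q) :
    Prec (2 ^ a * p) (2 ^ b * q) ↔
      (1 < p ∧ 1 < q ∧ (a < b ∨ (a = b ∧ p < q))) ∨ (1 < p ∧ q = 1) ∨
        (p = 1 ∧ q = 1 ∧ b < a) := by
  constructor
  · rintro ⟨a', p', b', q', hp', hq', h1, h2, h⟩
    obtain ⟨rfl, rfl⟩ := (two_pow_mul_odd_inj hp hp').1 h1
    obtain ⟨rfl, rfl⟩ := (two_pow_mul_odd_inj hq hq').1 h2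
    exact h
  · exact fun h => ⟨a, p, b, q, hp, hq, rfl, rfl, h⟩

lemma two_pow_prec_two_pow_iff : Prec (2 ^ a) (2 ^ b) ↔ b < a := by
  simpa using prec_iff (a := a) (b := b) odd_one odd_one

lemma prec_two_pow (hp : Odd p) (hp1 : 1 < p) : Prec (2 ^ a * p) (2 ^ b) :=
  ⟨a, p, b, 1, hp, odd_one, rfl, (mul_one _).symm, Or.inr (Or.inl ⟨hp1, rfl⟩)⟩

lemma Prec.ne (h : Prec m n) : m ≠ n := by
  obtain ⟨a, p, b, q, hp, hq, rfl, rfl, h⟩ := h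
  rw [Ne, two_pow_mul_odd_inj hp hq]
  lia

lemma prec_trichotomous (hm : 0 < m) (hn : 0 < n) : Prec m n ∨ m = n ∨ Prec n m := by
  obtain ⟨a, p, hp, rfl⟩ := Nat.exists_eq_two_pow_mul_odd hm.ne'
  obtain ⟨b, q, hq, rfl⟩ := Nat.exists_eq_two_pow_mul_odd hn.ne'
  rw [prec_iff hp hq, prec_iff hq hp, two_pow_mul_odd_inj hp hq]
  have := hp.pos
  have := hq.pos
  omega

lemma precEq_three (hn : 0 < n) : PrecEq 3 n := by
  obtain ⟨b, q, hq, rfl⟩ := Nat.exists_eq_two_pow_mul_odd hn.ne'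
  have h3 : Odd 3 := by decide
  have := prec_iff (a := 0) (b := b) h3 hq
  have := two_pow_mul_odd_inj (a := 0) (b := b) h3 hq
  obtain ⟨r, rfl⟩ := hq
  simp only [PrecEq, pow_zero, one_mul] at *
  lia

lemma IsTail.eq_setOf_precEq (hS : IsTail S) (hm : m ∈ S) (hmin : ∀ n ∈ S, ¬Prec n m) :
    S = {n | PrecEq m n} := by
  obtain ⟨-, hpos, hcl⟩ := hS
  ext n
  constructor
  · intro hn
    obtain h | h | h := prec_trichotomous (hpos m hm) (hpos n hn)
    · exact Or.inr h
    · exact Or.inl h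
    · exact absurd h (hmin n hn)
  · rintro (rfl | h)
    · exact hm
    · exact hcl m hm n h

lemma exists_forall_not_prec_of_odd (hpos : ∀ n ∈ S, 0 < n) (hp : Odd p) (hp1 : 1 < p)
    (hS : 2 ^ a * p ∈ S) : ∃ m ∈ S, ∀ n ∈ S, ¬Prec n m := by
  classical
  have hex : ∃ a, ∃ p, Odd p ∧ 1 < p ∧ 2 ^ a * p ∈ S := ⟨a, p, hp, hp1, hS⟩
  have hex' := Nat.find_spec hex
  obtain ⟨hq, hq1, hqS⟩ := Nat.find_spec hex'
  refine ⟨_, hqS, fun n hn => ?_⟩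
  obtain ⟨b, r, hr, rfl⟩ := Nat.exists_eq_two_pow_mul_odd (hpos n hn).ne'
  rw [prec_iff hr hq]
  rintro (⟨hr1, -, hlt | ⟨rfl, hlt⟩⟩ | ⟨-, h⟩ | ⟨-, h, -⟩)
  · exact Nat.find_min hex hlt ⟨r, hr, hr1, hn⟩
  · exact Nat.find_min hex' hlt ⟨hr, hr1, hn⟩
  all_goals lia

lemma IsTail.principal_or_eq_two_pow_of_subset (hS : IsTail S)
    (hpow : ∀ n ∈ S, ∃ i : ℕ, n = 2 ^ i) :
    (∃ k, 0 < k ∧ S = {n | PrecEq k n}) ∨ S = {n | ∃ i : ℕ, n = 2 ^ i} := by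
  obtain ⟨N, hN⟩ := hS.1
  obtain ⟨i₀, rfl⟩ := hpow N hN
  by_cases hbdd : BddAbove {i : ℕ | 2 ^ i ∈ S}
  · have hmax := Nat.sSup_mem (s := {i : ℕ | 2 ^ i ∈ S}) ⟨i₀, hN⟩ hbdd
    refine Or.inl ⟨_, by positivity, hS.eq_setOf_precEq hmax fun n hn => ?_⟩
    obtain ⟨i, rfl⟩ := hpow n hn
    rw [two_pow_prec_two_pow_iff, not_lt]
    exact le_csSup hbdd hn
  · refine Or.inr (Set.ext fun n => ⟨hpow n, ?_⟩)
    rintro ⟨j, rfl⟩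
    obtain ⟨i, hi, hji⟩ := not_bddAbove_iff.1 hbdd j
    exact hS.2.2 _ hi _ (two_pow_prec_two_pow_iff.2 hji)

lemma IsTail.principal_or_eq_two_pow (hS : IsTail S) :
    (∃ k, 0 < k ∧ S = {n | PrecEq k n}) ∨ S = {n | ∃ i : ℕ, n = 2 ^ i} := by
  by_cases hpow : ∀ n ∈ S, ∃ i : ℕ, n = 2 ^ i
  · exact hS.principal_or_eq_two_pow_of_subset hpow
  · push Not at hpow
    obtain ⟨n, hn, hnpow⟩ := hpow
    obtain ⟨a, p, hp, rfl⟩ := Nat.exists_eq_two_pow_mul_odd (hS.2.1 n hn).ne'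
    have hp1 : p ≠ 1 := fun h => hnpow a (by rw [h, mul_one])
    have hp0 := hp.pos
    obtain ⟨m, hm, hmin⟩ := exists_forall_not_prec_of_odd hS.2.1 hp (by lia) hn
    exact Or.inl ⟨m, hS.2.1 m hm, hS.eq_setOf_precEq hm hmin⟩

end Ordering

section Conjugation

lemma periods_comp_of_leftInverse {β : Type*} {φ : α → β} {r : β → α} (h : LeftInverse r φ)
    (f : α → α) : periods (φ ∘ f ∘ r) = periods f := by
  have hsemi : Semiconj φ f (φ ∘ f ∘ r) := fun x => by simp only [comp_apply, h x]
  have hmin (x : α) : minimalPeriod (φ ∘ f ∘ r) (φ x) = minimalPeriod f x :=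
    minimalPeriod_eq_minimalPeriod_iff.2 fun n => by
      rw [IsPeriodicPt, IsFixedPt, ← hsemi.iterate_right n x, h.injective.eq_iff]
      rfl
  ext n
  constructor
  · rintro ⟨hn, y, rfl⟩
    obtain ⟨z, rfl⟩ := periodicPts_subset_range (minimalPeriod_pos_iff_mem_periodicPts.1 hn)
    exact ⟨hn, f (r z), (hmin _).symm⟩
  · rintro ⟨hn, x, rfl⟩
    exact ⟨hn, φ x, hmin x⟩

lemma exists_continuous_periods_eq {s : Set ℝ} (hs : s.OrdConnected) (hs' : s.Nontrivial)
    {f : Icc (0 : ℝ) 1 → Icc (0 : ℝ) 1} (hf : Continuous f) :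
    ∃ g : s → s, Continuous g ∧ periods g = periods f := by
  obtain ⟨a, ha, b, hb, hab⟩ := hs'.exists_lt
  have hsub : Icc a b ⊆ s := hs.out ha hb
  let e := iccHomeoI a b hab
  have hinv : LeftInverse (fun x : s => e (projIcc a b hab.le x))
      (fun t => inclusion hsub (e.symm t)) := fun t => by
    simp only [projIcc_val, Homeomorph.apply_symm_apply]
  refine ⟨_, ?_, periods_comp_of_leftInverse hinv f⟩
  exact ((continuous_inclusion hsub).comp e.symm.continuous).comp
    (hf.comp (e.continuous.comp (continuous_projIcc.comp continuous_subtype_val)))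

end Conjugation

/-- The map `f` truncated at the heights `lo ≤ hi`; for `f = tent` this is `truncTent`. -/
def truncation [LinearOrder α] (f : α → α) (lo hi x : α) : α := max lo (min hi (f x))

/-- A period-`n` orbit of `f` with no other period-`n` orbit of `f` strictly inside its convex
hull. This property of a shortest orbit makes sense without a metric. -/
def IsInnermostOrbit [ConditionallyCompleteLinearOrder α] (f : α → α) (n : ℕ) (P : Set α) :
    Prop :=
  IsPeriodicOrbit f n P ∧ ∀ R, IsPeriodicOrbit f n R → ¬R ⊆ Ioo (sInf P) (sSup P)

section Truncation

lemma IsPeriodicOrbit.congr {f g : α → α} {n : ℕ} {P : Set α} (hP : IsPeriodicOrbit f n P)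
    (hfg : EqOn f g P) : IsPeriodicOrbit g n P := by
  obtain ⟨x, hx⟩ := hP.nonempty
  have hiter (k : ℕ) : g^[k] x = f^[k] x := by
    induction k with
    | zero => rfl
    | succ k ih => rw [iterate_succ_apply', iterate_succ_apply', ih, hfg (hP.iterate_mem hx k)]
  refine ⟨hP.1, x, ?_, ?_⟩
  · rw [← hP.minimalPeriod_eq hx, minimalPeriod_eq_minimalPeriod_iff]
    intro k
    rw [IsPeriodicPt, IsFixedPt, hiter]
    rfl
  · simp only [hiter]
    exact hP.eq_range hx

variable [LinearOrder α] {f : α → α} {lo hi x : α} {n : ℕ} {P R : Set α}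

lemma truncation_mem_Icc (h : lo ≤ hi) (x : α) : truncation f lo hi x ∈ Icc lo hi :=
  ⟨le_max_left _ _, max_le h (min_le_left _ _)⟩

lemma truncation_eq_of_mem_Icc (h : f x ∈ Icc lo hi) : truncation f lo hi x = f x := by
  rw [truncation, min_eq_right h.2, max_eq_right h.1]

lemma truncation_eq_of_ne (hlo : truncation f lo hi x ≠ lo) (hhi : truncation f lo hi x ≠ hi) :
    truncation f lo hi x = f x := by
  unfold truncation at *
  grind

lemma continuous_truncation [TopologicalSpace α] [OrderClosedTopology α] (hf : Continuous f)
    (lo hi : α) : Continuous (truncation f lo hi) :=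
  continuous_const.max (continuous_const.min hf)

namespace IsPeriodicOrbit

lemma truncation_of_subset_Icc (hP : IsPeriodicOrbit f n P) (hsub : P ⊆ Icc lo hi) :
    IsPeriodicOrbit (truncation f lo hi) n P :=
  hP.congr fun _ hx => (truncation_eq_of_mem_Icc (hsub (hP.apply_mem hx))).symm

lemma of_truncation (hR : IsPeriodicOrbit (truncation f lo hi) n R) (hlo : lo ∉ R)
    (hhi : hi ∉ R) : IsPeriodicOrbit f n R :=
  hR.congr fun _ hx => truncation_eq_of_ne (ne_of_mem_of_not_mem (hR.apply_mem hx) hlo)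
    (ne_of_mem_of_not_mem (hR.apply_mem hx) hhi)

lemma subset_Ioo_of_truncation (hle : lo ≤ hi) (hR : IsPeriodicOrbit (truncation f lo hi) n R)
    (hlo : lo ∉ R) (hhi : hi ∉ R) : R ⊆ Ioo lo hi := by
  intro x hx
  obtain ⟨y, -, rfl⟩ := hR.exists_apply_eq hx
  have hmem := truncation_mem_Icc (f := f) hle y
  exact ⟨hmem.1.lt_of_ne' (ne_of_mem_of_not_mem hx hlo),
    hmem.2.lt_of_ne (ne_of_mem_of_not_mem hx hhi)⟩

end IsPeriodicOrbit

lemma exists_isPeriodicOrbit_subset_Ioo (hle : lo ≤ hi) (hn : n ∈ periods (truncation f lo hi))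
    (hlo : minimalPeriod (truncation f lo hi) lo ≠ n)
    (hhi : minimalPeriod (truncation f lo hi) hi ≠ n) :
    ∃ R, IsPeriodicOrbit f n R ∧ R ⊆ Ioo lo hi := by
  obtain ⟨R, hR⟩ := mem_periods_iff_exists_isPeriodicOrbit.1 hn
  have hloR : lo ∉ R := fun h => hlo (hR.minimalPeriod_eq h)
  have hhiR : hi ∉ R := fun h => hhi (hR.minimalPeriod_eq h)
  exact ⟨R, hR.of_truncation hloR hhiR, hR.subset_Ioo_of_truncation hle hloR hhiR⟩

end Truncation

section Innermost

variable [ConditionallyCompleteLinearOrder α] {f : α → α} {P R : Set α} {lo hi : α} {k m n : ℕ}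

namespace IsPeriodicOrbit

lemma truncation_csInf_csSup (hP : IsPeriodicOrbit f n P) :
    IsPeriodicOrbit (truncation f (sInf P) (sSup P)) n P :=
  hP.truncation_of_subset_Icc hP.subset_Icc

end IsPeriodicOrbit

variable [TopologicalSpace α] [OrderTopology α] [DenselyOrdered α]

lemma IsPeriodicOrbit.exists_subset_Ioo (hf : Continuous f) (hP : IsPeriodicOrbit f m P)
    (h : Prec m n) : ∃ R, IsPeriodicOrbit f n R ∧ R ⊆ Ioo (sInf P) (sSup P) := by
  have hT := hP.truncation_csInf_csSup
  have hm : m ∈ periods (truncation f (sInf P) (sSup P)) :=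
    mem_periods_iff_exists_isPeriodicOrbit.2 ⟨P, hT⟩
  refine exists_isPeriodicOrbit_subset_Ioo hP.csInf_le_csSup
    (mem_periods_of_prec (continuous_truncation hf _ _) hm h) ?_ ?_
  · exact (hT.minimalPeriod_eq hP.csInf_mem).trans_ne h.ne
  · exact (hT.minimalPeriod_eq hP.csSup_mem).trans_ne h.ne

namespace IsInnermostOrbit

/- An orbit of the earlier period `m`, strictly inside `P`, would force another orbit of
period `n` inside `P`; so it has to meet a truncation height. -/
lemma minimalPeriod_eq_or_eq (hf : Continuous f) (hP : IsInnermostOrbit f n P)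
    (hlo : sInf P ≤ lo) (hhi : hi ≤ sSup P) (hle : lo ≤ hi)
    (hm : m ∈ periods (truncation f lo hi)) (h : Prec m n) :
    minimalPeriod (truncation f lo hi) lo = m ∨ minimalPeriod (truncation f lo hi) hi = m := by
  by_contra! hne
  obtain ⟨R, hR, hRsub⟩ := exists_isPeriodicOrbit_subset_Ioo hle hm hne.1 hne.2
  obtain ⟨R', hR', hR'sub⟩ := hR.exists_subset_Ioo hf h
  exact hP.2 R' hR' (hR'sub.trans (Ioo_subset_Ioo (hlo.trans (hRsub hR.csInf_mem).1.le)
    ((hRsub hR.csSup_mem).2.le.trans hhi)))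

theorem periods_truncation (hf : Continuous f) (hP : IsInnermostOrbit f n P) :
    periods (truncation f (sInf P) (sSup P)) = {k | PrecEq n k} := by
  have hT := hP.1.truncation_csInf_csSup
  have hn : n ∈ periods (truncation f (sInf P) (sSup P)) :=
    mem_periods_iff_exists_isPeriodicOrbit.2 ⟨P, hT⟩
  ext k
  constructor
  · intro hk
    obtain h | h | h := prec_trichotomous hn.1 hk.1
    · exact Or.inr h
    · exact Or.inl h
    · have := hP.minimalPeriod_eq_or_eq hf le_rfl le_rfl hP.1.csInf_le_csSup hk h
      rw [hT.minimalPeriod_eq hP.1.csInf_mem, hT.minimalPeriod_eq hP.1.csSup_mem, or_self] at this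
      exact Or.inl this
  · rintro (rfl | h)
    · exact hn
    · exact mem_periods_of_prec (continuous_truncation hf _ _) hn h

end IsInnermostOrbit

end Innermost

section Limit

lemma exists_mem_forall_subset_of_antitone {𝓡 : Set (Set α)} (h𝓡 : 𝓡.Finite) {K : ℕ → Set α}
    (hK : Antitone K) (h : ∀ i, ∃ R ∈ 𝓡, R ⊆ K i) : ∃ R ∈ 𝓡, ∀ i, R ⊆ K i := by
  by_contra! hcon
  choose! i hi using hcon
  obtain ⟨N, hN⟩ := (h𝓡.image i).bddAbove
  obtain ⟨R, hR, hRN⟩ := h N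
  exact hi R hR (hRN.trans (hK (hN (mem_image_of_mem i hR))))

variable [ConditionallyCompleteLinearOrder α] [TopologicalSpace α] [OrderTopology α]
  [DenselyOrdered α] {f : α → α} {Q : ℕ → Set α} {q₀ q₁ : α}

lemma two_pow_mem_periods_truncation (hf : Continuous f)
    (hQ : ∀ i, IsInnermostOrbit f (2 ^ i * 3) (Q i))
    (hnest : Antitone fun i => Icc (sInf (Q i)) (sSup (Q i)))
    (hq₀ : IsLUB (range fun i => sInf (Q i)) q₀) (hq₁ : IsGLB (range fun i => sSup (Q i)) q₁)
    {j : ℕ} (hfin : {R | IsPeriodicOrbit f (2 ^ j) R}.Finite) :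
    2 ^ j ∈ periods (truncation f q₀ q₁) := by
  obtain ⟨R, hR, hRsub⟩ := exists_mem_forall_subset_of_antitone hfin hnest fun i => by
    obtain ⟨R, hR, hRsub⟩ := (hQ i).1.exists_subset_Ioo hf
      (prec_two_pow (b := j) (by decide) (by norm_num))
    exact ⟨R, hR, hRsub.trans Ioo_subset_Icc_self⟩
  have hR' : IsPeriodicOrbit f (2 ^ j) R := hR
  refine mem_periods_iff_exists_isPeriodicOrbit.2 ⟨R, hR'.truncation_of_subset_Icc fun x hx => ?_⟩
  exact ⟨hq₀.2 (forall_mem_range.2 fun i => (hRsub i hx).1),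
    hq₁.2 (forall_mem_range.2 fun i => (hRsub i hx).2)⟩

/- If `2 ^ a * p` were a period with `p > 1` odd, then so would be every `2 ^ b * p` with `b > a`,
but only the periods of the two truncation heights can occur. -/
lemma exists_eq_two_pow_of_mem_periods_truncation (hf : Continuous f)
    (hQ : ∀ i, IsInnermostOrbit f (2 ^ i * 3) (Q i)) (hlo : ∀ i, sInf (Q i) ≤ q₀)
    (hhi : ∀ i, q₁ ≤ sSup (Q i)) (hle : q₀ ≤ q₁) {n : ℕ}
    (hn : n ∈ periods (truncation f q₀ q₁)) : ∃ i, n = 2 ^ i := by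
  by_contra! hpow
  obtain ⟨a, p, hp, rfl⟩ := Nat.exists_eq_two_pow_mul_odd hn.1.ne'
  have hp1 : 1 < p := by
    have := hp.pos
    have : p ≠ 1 := fun h => hpow a (by rw [h, mul_one])
    lia
  have h3 : Odd 3 := by decide
  have hperiods (c : ℕ) : 2 ^ (a + 1 + c) * p ∈ periods (truncation f q₀ q₁) :=
    mem_periods_of_prec (continuous_truncation hf _ _) hn ((prec_iff hp hp).2 (by lia))
  have hheights (c : ℕ) : 2 ^ (a + 1 + c) * p ∈
      ({minimalPeriod (truncation f q₀ q₁) q₀, minimalPeriod (truncation f q₀ q₁) q₁} : Set ℕ) :=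
    ((hQ (a + 2 + c)).minimalPeriod_eq_or_eq hf (hlo _) (hhi _) hle (hperiods c)
      ((prec_iff hp h3).2 (by lia))).imp Eq.symm Eq.symm
  have hinj : Injective fun c => 2 ^ (a + 1 + c) * p := fun c d h =>
    Nat.add_left_cancel ((two_pow_mul_odd_inj hp hp).1 h).1
  exact infinite_of_injective_forall_mem hinj hheights (toFinite _)

theorem periods_truncation_of_isLUB_of_isGLB (hf : Continuous f)
    (hQ : ∀ i, IsInnermostOrbit f (2 ^ i * 3) (Q i))
    (hnest : Antitone fun i => Icc (sInf (Q i)) (sSup (Q i)))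
    (hq₀ : IsLUB (range fun i => sInf (Q i)) q₀) (hq₁ : IsGLB (range fun i => sSup (Q i)) q₁)
    (hfin : ∀ j, {R | IsPeriodicOrbit f (2 ^ j) R}.Finite) :
    periods (truncation f q₀ q₁) = {n | ∃ i, n = 2 ^ i} := by
  have hmem (i : ℕ) : sInf (Q i) ∈ Icc (sInf (Q i)) (sSup (Q i)) :=
    left_mem_Icc.2 (hQ i).1.csInf_le_csSup
  have hle (i j : ℕ) : sInf (Q i) ≤ sSup (Q j) := by
    have hi := hnest (le_max_left i j) (hmem (max i j))
    have hj := hnest (le_max_right i j) (hmem (max i j))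
    exact hi.1.trans hj.2
  have hq : q₀ ≤ q₁ := hq₀.2 (forall_mem_range.2 fun i => hq₁.2 (forall_mem_range.2 (hle i)))
  ext n
  constructor
  · exact exists_eq_two_pow_of_mem_periods_truncation hf hQ
      (fun i => hq₀.1 (mem_range_self i)) (fun i => hq₁.1 (mem_range_self i)) hq
  · rintro ⟨j, rfl⟩
    exact two_pow_mem_periods_truncation hf hQ hnest hq₀ hq₁ (hfin j)

end Limit

section Tent

variable {A P R : Set (Icc (0 : ℝ) 1)} {k : ℕ} {Q : ℕ → Set (Icc (0 : ℝ) 1)}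

lemma continuous_tent : Continuous tent := by
  unfold tent
  fun_prop

lemma continuous_truncTent (lo hi : Icc (0 : ℝ) 1) : Continuous (truncTent lo hi) :=
  continuous_truncation continuous_tent lo hi

lemma exists_int_tent_iterate_eq (k : ℕ) (x : Icc (0 : ℝ) 1) :
    ∃ m : ℤ, (tent^[k] x : ℝ) = m + 2 ^ k * x ∨ (tent^[k] x : ℝ) = m - 2 ^ k * x := by
  induction k with
  | zero => exact ⟨0, by simp⟩
  | succ k ih =>
    obtain ⟨m, hm⟩ := ih
    have htent : (tent^[k + 1] x : ℝ) = 1 - |2 * (tent^[k] x : ℝ) - 1| := by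
      rw [iterate_succ_apply']
      rfl
    obtain h | h := abs_choice (2 * (tent^[k] x : ℝ) - 1)
    · refine ⟨2 - 2 * m, ?_⟩
      rw [htent, h]
      push_cast
      grind
    · refine ⟨2 * m, ?_⟩
      rw [htent, h]
      push_cast
      grind

lemma finite_setOf_mul_eq_int {c : ℝ} (hc : c ≠ 0) :
    {x : Icc (0 : ℝ) 1 | ∃ m : ℤ, c * x = m}.Finite := by
  let floor (x : Icc (0 : ℝ) 1) : ℤ := ⌊c * (x : ℝ)⌋
  refine Set.Finite.of_injOn (f := floor) (t := Icc ⌊-|c|⌋ ⌊|c|⌋) (fun x _ => ?_) ?_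
    (finite_Icc _ _)
  · have habs : |c * (x : ℝ)| ≤ |c| := by
      rw [abs_mul, abs_of_nonneg x.2.1]
      exact mul_le_of_le_one_right (abs_nonneg c) x.2.2
    exact ⟨Int.floor_le_floor (abs_le.1 habs).1, Int.floor_le_floor (abs_le.1 habs).2⟩
  · rintro x ⟨m, hm⟩ y ⟨l, hl⟩ hxy
    simp only [floor, hm, hl, Int.floor_intCast] at hxy
    exact Subtype.ext (mul_left_cancel₀ hc (by rw [hm, hl, hxy]))

lemma finite_setOf_isPeriodicPt_tent (hk : 0 < k) : {x | IsPeriodicPt tent k x}.Finite := by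
  have h1 : (1 : ℝ) < 2 ^ k := one_lt_pow₀ one_lt_two hk.ne'
  have hminus : (1 - 2 ^ k : ℝ) ≠ 0 := by linarith
  have hplus : (1 + 2 ^ k : ℝ) ≠ 0 := by linarith
  refine ((finite_setOf_mul_eq_int hminus).union (finite_setOf_mul_eq_int hplus)).subset ?_
  intro x (hx : tent^[k] x = x)
  obtain ⟨m, hm⟩ := exists_int_tent_iterate_eq k x
  rw [hx] at hm
  exact hm.imp (fun h => ⟨m, by linarith⟩) (fun h => ⟨m, by linarith⟩)

lemma finite_setOf_isPeriodicOrbit_tent (hk : 0 < k) : {P | IsPeriodicOrbit tent k P}.Finite :=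
  (finite_setOf_isPeriodicPt_tent hk).finite_subsets.subset
    fun _ (hP : IsPeriodicOrbit tent k _) _ hx => hP.iterate_eq_self hx

lemma exists_isSmallestOrbitIn (hR : IsPeriodicOrbit tent k R) (hRA : R ⊆ A) :
    ∃ P, IsSmallestOrbitIn A k P := by
  have hfin : {P | IsPeriodicOrbit tent k P ∧ P ⊆ A}.Finite :=
    (finite_setOf_isPeriodicOrbit_tent hR.1).subset fun _ hP => hP.1
  obtain ⟨P, ⟨hP, hPA⟩, hmin⟩ := exists_min_image _ diam hfin ⟨R, hR, hRA⟩
  exact ⟨P, hP, hPA, fun R' hR' hRA' => hmin R' ⟨hR', hRA'⟩⟩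

lemma IsSmallestOrbitIn.isInnermostOrbit (hA : A.OrdConnected) (hP : IsSmallestOrbitIn A k P) :
    IsInnermostOrbit tent k P := by
  obtain ⟨hP, hPA, hmin⟩ := hP
  refine ⟨hP, fun R hR hRP => ?_⟩
  have hRA : R ⊆ A :=
    hRP.trans (Ioo_subset_Icc_self.trans (hA.out (hPA hP.csInf_mem) (hPA hP.csSup_mem)))
  exact (hmin R hR hRA).not_gt
    (sub_lt_sub (hRP hR.csSup_mem).2 (hRP hR.csInf_mem).1)

lemma three_mem_periods_tent : 3 ∈ periods tent := by
  let x : Icc (0 : ℝ) 1 := ⟨2 / 7, by norm_num, by norm_num⟩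
  have h1 : (tent x : ℝ) = 4 / 7 := by
    change 1 - |2 * (2 / 7 : ℝ) - 1| = 4 / 7
    norm_num [abs_of_neg]
  have h2 : (tent (tent x) : ℝ) = 6 / 7 := by
    change 1 - |2 * (tent x : ℝ) - 1| = 6 / 7
    norm_num [h1, abs_of_pos]
  have h3 : (tent (tent (tent x)) : ℝ) = 2 / 7 := by
    change 1 - |2 * (tent (tent x) : ℝ) - 1| = 2 / 7
    norm_num [h2, abs_of_pos]
  have : Fact (Nat.Prime 3) := ⟨Nat.prime_three⟩
  refine ⟨three_pos, x, minimalPeriod_eq_prime (Subtype.ext h3) fun h => ?_⟩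
  have hx : (tent x : ℝ) = 2 / 7 := congrArg Subtype.val h
  norm_num [h1] at hx

lemma mem_periods_tent (hk : 0 < k) : k ∈ periods tent := by
  obtain rfl | h := precEq_three hk
  · exact three_mem_periods_tent
  · exact mem_periods_of_prec continuous_tent three_mem_periods_tent h

lemma exists_isSmallestOrbitIn_univ (hk : 0 < k) : ∃ P, IsSmallestOrbitIn univ k P := by
  obtain ⟨R, hR⟩ := mem_periods_iff_exists_isPeriodicOrbit.1 (mem_periods_tent hk)
  exact exists_isSmallestOrbitIn hR (subset_univ R)

theorem periods_truncTent (hP : IsSmallestOrbitIn univ k P) :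
    periods (truncTent (sInf P) (sSup P)) = {n | PrecEq k n} :=
  (hP.isInnermostOrbit ordConnected_univ).periods_truncation continuous_tent

lemma exists_isSmallestOrbitIn_Icc {i : ℕ} (hP : IsPeriodicOrbit tent (2 ^ i * 3) P) :
    ∃ R, IsSmallestOrbitIn (Icc (sInf P) (sSup P)) (2 ^ (i + 1) * 3) R := by
  have h3 : Odd 3 := by decide
  obtain ⟨R, hR, hRP⟩ :=
    hP.exists_subset_Ioo (n := 2 ^ (i + 1) * 3) continuous_tent ((prec_iff h3 h3).2 (by lia))
  exact exists_isSmallestOrbitIn hR (hRP.trans Ioo_subset_Icc_self)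

lemma exists_isNestedChoice : ∃ Q, IsNestedChoice Q := by
  obtain ⟨P, hP⟩ := exists_isSmallestOrbitIn_univ three_pos
  choose! next hnext using fun (i : ℕ) P => exists_isSmallestOrbitIn_Icc (i := i) (P := P)
  let Q (i : ℕ) : Set (Icc (0 : ℝ) 1) := Nat.rec P next i
  have hQ (i : ℕ) : IsPeriodicOrbit tent (2 ^ i * 3) (Q i) := by
    induction i with
    | zero => exact hP.1
    | succ i ih => exact (hnext i (Q i) ih).1
  exact ⟨Q, hP, fun i => hnext i (Q i) (hQ i)⟩

namespace IsNestedChoice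

lemma isInnermostOrbit (hQ : IsNestedChoice Q) (i : ℕ) :
    IsInnermostOrbit tent (2 ^ i * 3) (Q i) := by
  cases i with
  | zero => exact hQ.1.isInnermostOrbit ordConnected_univ
  | succ i => exact (hQ.2 i).isInnermostOrbit ordConnected_Icc

lemma antitone_Icc (hQ : IsNestedChoice Q) : Antitone fun i => Icc (sInf (Q i)) (sSup (Q i)) :=
  antitone_nat_of_succ_le fun i =>
    Icc_subset_Icc ((hQ.2 i).2.1 (hQ.2 i).1.csInf_mem).1 ((hQ.2 i).2.1 (hQ.2 i).1.csSup_mem).2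

theorem periods_limTent (hQ : IsNestedChoice Q) : periods (limTent Q) = {n | ∃ i, n = 2 ^ i} :=
  periods_truncation_of_isLUB_of_isGLB continuous_tent hQ.isInnermostOrbit hQ.antitone_Icc
    isLUB_iSup isGLB_iInf fun _ => finite_setOf_isPeriodicOrbit_tent (by positivity)

end IsNestedChoice

end Tent

section Realization

variable {s : Set ℝ}

theorem exists_continuous_periods_eq_of_isTail (hs : s.OrdConnected) (hs' : s.Nontrivial)
    {S : Set ℕ} (hS : IsTail S) : ∃ f : s → s, Continuous f ∧ periods f = S := by
  obtain ⟨k, hk, rfl⟩ | rfl := hS.principal_or_eq_two_pow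
  · obtain ⟨P, hP⟩ := exists_isSmallestOrbitIn_univ hk
    rw [← periods_truncTent hP]
    exact exists_continuous_periods_eq hs hs' (continuous_truncTent _ _)
  · obtain ⟨Q, hQ⟩ := exists_isNestedChoice
    rw [← hQ.periods_limTent]
    exact exists_continuous_periods_eq hs hs' (continuous_truncTent _ _)

theorem forall_mem_periods_iff_precEq (hs : s.OrdConnected) (hs' : s.Nontrivial) {m n : ℕ}
    (hm : 0 < m) :
    (∀ f : s → s, Continuous f → m ∈ periods f → n ∈ periods f) ↔ PrecEq m n := by
  constructor
  · intro h
    obtain ⟨P, hP⟩ := exists_isSmallestOrbitIn_univ hm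
    obtain ⟨f, hf, hperiods⟩ :=
      exists_continuous_periods_eq hs hs' (continuous_truncTent (sInf P) (sSup P))
    rw [periods_truncTent hP] at hperiods
    exact hperiods.subset (h f hf (hperiods.superset (Or.inl rfl)))
  · rintro (rfl | hmn) f hf hmem
    · exact hmem
    · have : Inhabited s := ⟨⟨_, hs'.nonempty.some_mem⟩⟩
      exact mem_periods_of_prec hf hmem hmn

end Realization

end Sharkovsky

universe u

theorem theorem6_general :
    (∀ (α : Type u) [ConditionallyCompleteLinearOrder α] [TopologicalSpace α] [OrderTopology α]
      [DenselyOrdered α] (f : α → α), Continuous f →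
      ∀ m ∈ Sharkovsky.periods f, ∀ n : ℕ, Sharkovsky.Prec m n → n ∈ Sharkovsky.periods f) ∧
    (∀ s : Set ℝ, s.OrdConnected → s.Nontrivial → ∀ m n : ℕ, 0 < m →
      ((∀ f : s → s, Continuous f →
          m ∈ Sharkovsky.periods f → n ∈ Sharkovsky.periods f) ↔
        Sharkovsky.PrecEq m n)) ∧
    (∀ s : Set ℝ, s.OrdConnected → s.Nontrivial → ∀ S : Set ℕ, Sharkovsky.IsTail S →
      ∃ f : s → s, Continuous f ∧ Sharkovsky.periods f = S) ∧
    (∀ k : ℕ, 0 < k →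
      (∃ P, Sharkovsky.IsSmallestOrbitIn Set.univ k P) ∧
      ∀ P, Sharkovsky.IsSmallestOrbitIn Set.univ k P →
        Continuous (Sharkovsky.truncTent (sInf P) (sSup P)) ∧
        Sharkovsky.periods (Sharkovsky.truncTent (sInf P) (sSup P)) =
          {n : ℕ | Sharkovsky.PrecEq k n}) ∧
    ((∃ Q, Sharkovsky.IsNestedChoice Q) ∧
      ∀ Q, Sharkovsky.IsNestedChoice Q →
        Continuous (Sharkovsky.limTent Q) ∧
        Sharkovsky.periods (Sharkovsky.limTent Q) = {n : ℕ | ∃ i : ℕ, n = 2 ^ i}) :=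
  ⟨fun _ _ _ _ _ _ hf _ hm _ h => Sharkovsky.mem_periods_of_prec hf hm h,
    fun _ hs hs' _ _ hm => Sharkovsky.forall_mem_periods_iff_precEq hs hs' hm,
    fun _ hs hs' _ hS => Sharkovsky.exists_continuous_periods_eq_of_isTail hs hs' hS,
    fun _ hk => ⟨Sharkovsky.exists_isSmallestOrbitIn_univ hk, fun _ hP =>
      ⟨Sharkovsky.continuous_truncTent _ _, Sharkovsky.periods_truncTent hP⟩⟩,
    Sharkovsky.exists_isNestedChoice, fun _ hQ =>
      ⟨Sharkovsky.continuous_truncTent _ _, hQ.periods_limTent⟩⟩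

theorem theorem6 :
    -- a continuous self-map of a compact interval with a point of least period `m` has points
    -- of least period `n` for all `n` after `m`
    (∀ a b : ℝ, a ≤ b → ∀ f : Set.Icc a b → Set.Icc a b, Continuous f →
      ∀ m ∈ Sharkovsky.periods f, ∀ n : ℕ, Sharkovsky.Prec m n → n ∈ Sharkovsky.periods f) ∧
    -- and these (with `m` itself) are precisely the periods forced by `m`
    (∀ a b : ℝ, a < b → ∀ m n : ℕ, 0 < m → 0 < n →
      ((∀ f : Set.Icc a b → Set.Icc a b, Continuous f →
          m ∈ Sharkovsky.periods f → n ∈ Sharkovsky.periods f) ↔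
        Sharkovsky.PrecEq m n)) ∧
    -- every tail is the set of periods of a continuous map of the given interval
    (∀ a b : ℝ, a < b → ∀ S : Set ℕ, Sharkovsky.IsTail S →
      ∃ f : Set.Icc a b → Set.Icc a b, Continuous f ∧ Sharkovsky.periods f = S) ∧
    -- the truncated tent maps `T_k`
    (∀ k : ℕ, 0 < k →
      (∃ P, Sharkovsky.IsSmallestOrbitIn Set.univ k P) ∧
      ∀ P, Sharkovsky.IsSmallestOrbitIn Set.univ k P →
        Continuous (Sharkovsky.truncTent (sInf P) (sSup P)) ∧
        Sharkovsky.periods (Sharkovsky.truncTent (sInf P) (sSup P)) =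
          {n : ℕ | Sharkovsky.PrecEq k n}) ∧
    -- the limiting truncation `T_∞`
    ((∃ Q, Sharkovsky.IsNestedChoice Q) ∧
      ∀ Q, Sharkovsky.IsNestedChoice Q →
        Continuous (Sharkovsky.limTent Q) ∧
        Sharkovsky.periods (Sharkovsky.limTent Q) = {n : ℕ | ∃ i : ℕ, n = 2 ^ i}) := by
  obtain ⟨hforce, hiff, hrealize, htent⟩ := theorem6_general
  have hI {a b : ℝ} (hab : a < b) : (Set.Icc a b).Nontrivial :=
    Set.nontrivial_of_lt (Set.left_mem_Icc.2 hab.le) (Set.right_mem_Icc.2 hab.le) hab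
  refine ⟨fun a b hab => ?_, fun a b hab m n hm _ => hiff _ Set.ordConnected_Icc (hI hab) m n hm,
    fun a b hab => hrealize _ Set.ordConnected_Icc (hI hab), htent⟩
  have : Inhabited (Set.Icc a b) := ⟨⟨a, Set.left_mem_Icc.2 hab⟩⟩
  exact hforce (Set.Icc a b)
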